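/- For $d\in\mathbb N$, $d\ge 1$, and $\eta\in(0,1/4)$ let $\pi_\eta$ be the probability measure on $\mathbb R^d$ with density proportional to $\exp(-V_\eta)$, where $$V_\eta(x)=\frac{\|x\|^2}{2}-\frac{1}{2d^{2\eta}}\sum_{i=1}^d\cos(d^\eta x_i).$$ For a step size $h>0$, the Metropolis-adjusted Langevin algorithm (MALA) with target $\pi=\pi_\eta$ is the Markov chain with transition kernel $$T(x,\mathrm dy)=\Bigl(1-\int Q(x,z)A(x,z)\,\mathrm dz\Bigr)\delta_x(\mathrm dy)+Q(x,y)A(x,y)\,\mathrm dy,$$ where $Q(x,y)=(4\pi h)^{-d/2}\exp\bigl(-\|y-x+h\nabla V_\eta(x)\|^2/(4h)\bigr)$ (with $\pi$ here the number) and $A(x,y)=\min\Bigl\{1,\frac{\pi_\eta(y)Q(y,x)}{\pi_\eta(x)Q(x,y)}\Bigr\}$. Its conductance is $$\mathsf C=\inf\Bigl\{\frac{\int_S T(x,S^{\mathsf c})\,\pi_\eta(\mathrm dx)}{\pi_\eta(S)}\;:\;S\subseteq\mathbb R^d\text{ Borel},\ 0<\pi_\eta(S)\le\tfrac12\Bigr\}.$$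 Theorem. Fix $\delta\in(0,1/18)$ and let $\eta=1/4-\delta$. There are constants $C,c>0$, depending only on $\delta$, such that for every $d\ge 1$ and every step size $h\in[d^{-1/2+3\delta},\,d^{-1/3}]$, the conductance of the MALA chain with target $\pi_\eta$ and step size $h$ satisfies $$\mathsf C\le C\exp(-c\,d^{4\delta}).$$ -/

import Mathlib

open scoped ENNReal
open MeasureTheory

namespace MALA

variable {d : ℕ}

/-- The normalized Lebesgue density of the distribution `π ∝ exp (-V)` on `ℝᵈ`. -/
noncomputable def targetDensity (V : EuclideanSpace ℝ (Fin d) → ℝ)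
    (x : EuclideanSpace ℝ (Fin d)) : ℝ :=
  Real.exp (-V x) / ∫ z, Real.exp (-V z)

/-- The target distribution `π ∝ exp (-V)` on `ℝᵈ`. -/
noncomputable def target (V : EuclideanSpace ℝ (Fin d) → ℝ) :
    Measure (EuclideanSpace ℝ (Fin d)) :=
  volume.withDensity fun x => ENNReal.ofReal (targetDensity V x)

/-- The Langevin proposal density `Q(x, y)` with step size `h`, that is, the density at `y` of the
Gaussian distribution with mean `x - h ∇V(x)` and covariance `2 h I`. -/
noncomputable def proposalDensity (V : EuclideanSpace ℝ (Fin d) → ℝ) (h : ℝ)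
    (x y : EuclideanSpace ℝ (Fin d)) : ℝ :=
  1 / (4 * Real.pi * h) ^ ((d : ℝ) / 2) *
    Real.exp (-‖y - x + h • gradient V x‖ ^ 2 / (4 * h))

/-- The Metropolis–Hastings acceptance probability of a move from `x` to `y`, that is,
`min 1 (π(y) Q(y, x) / (π(x) Q(x, y)))`. -/
noncomputable def acceptProb (V : EuclideanSpace ℝ (Fin d) → ℝ) (h : ℝ)
    (x y : EuclideanSpace ℝ (Fin d)) : ℝ :=
  min 1 ((targetDensity V y * proposalDensity V h y x) /
    (targetDensity V x * proposalDensity V h x y))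

/-- The overall acceptance probability at `x`, that is, `∫ Q(x, y) A(x, y) dy`. -/
noncomputable def totalAcceptProb (V : EuclideanSpace ℝ (Fin d) → ℝ) (h : ℝ)
    (x : EuclideanSpace ℝ (Fin d)) : ℝ≥0∞ :=
  ∫⁻ y, ENNReal.ofReal (proposalDensity V h x y * acceptProb V h x y)

/-- The transition kernel of the Metropolis-adjusted Langevin algorithm:
`T(x, ·) = (1 - A(x)) δ_x + Q(x, y) A(x, y) dy`. -/
noncomputable def kernel (V : EuclideanSpace ℝ (Fin d) → ℝ) (h : ℝ)
    (x : EuclideanSpace ℝ (Fin d)) : Measure (EuclideanSpace ℝ (Fin d)) :=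
  (1 - totalAcceptProb V h x) • Measure.dirac x +
    volume.withDensity fun y =>
      ENNReal.ofReal (proposalDensity V h x y * acceptProb V h x y)

/-- The conductance of a Markov transition kernel `T` with stationary distribution `π`: the infimum
of `(∫_S T(x, Sᶜ) π(dx)) / π(S)` over the Borel sets `S` with `0 < π(S) ≤ 1/2`. -/
noncomputable def conductance {E : Type*} [MeasurableSpace E] (T : E → Measure E)
    (π : Measure E) : ℝ≥0∞ :=
  ⨅ (S : Set E) (_ : MeasurableSet S) (_ : 0 < π S) (_ : π S ≤ 1 / 2),
    (∫⁻ x in S, T x Sᶜ ∂π) / π S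

/-- The potential `V_η(x) = ‖x‖² / 2 - (1 / (2 d^{2η})) ∑ᵢ cos (d^η xᵢ)` on `ℝᵈ`. -/
noncomputable def adversarialPotential (d : ℕ) (η : ℝ) (x : EuclideanSpace ℝ (Fin d)) : ℝ :=
  ‖x‖ ^ 2 / 2 - 1 / (2 * (d : ℝ) ^ (2 * η)) * ∑ i, Real.cos ((d : ℝ) ^ η * x i)

end MALA

namespace MALA

variable {d : ℕ}

/-! The stationary flow of accepted moves has density `min (p x y) (p y x)`, where `p x y = π(x)
Q(x, y)` is the flow of unadjusted proposals. Since `min a b ≤ √(a b)`, the flow out of any set is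
at most the Hellinger affinity between `p` and its reversal. So conductance is bounded by
near-universal rejection, not by a bottleneck: any set of mass exactly 1/2 will do, and evenness of
`V` supplies a half-space.

Target and proposal are products over coordinates, so the affinity is `coordAffinity L h ^ d` with
`L = d ^ η` (`lintegral_sqrt_flow_mul`). In one dimension the affinity is `1 - H² / 2`, with `H` the
Hellinger distance, and it remains to show that `H²` is at least a constant times `h / L²`
(`le_lintegral_sqrt_coordFlow_sub_sq`). The conductance is then at most `2 exp (-c d h / L²)`, and
the lower end of the step-size window gives `d h / L² ≥ d ^ (5δ)`.

For the bound on `H²`, the logarithm of `p y x / p x y` is the trapezoid-rule error for `V` on `[x,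
y]` plus a drift correction. The quadratic part of `V` has no trapezoid error. With `s = √h` and `y
- x` of order `s`, the sine terms contribute an oscillation of size `s / L`. They dominate the
cosine terms, of size `1 / L²`, when `L s` is large, and the drift correction, of size `s³`, when
`s² L` is small. The window ensures both for large `d`, and averaging the squared oscillation over
`x` and `y - x` leaves a fixed fraction of `s² / L²`. -/

/-- A finite product of nonnegative one-variable functions integrates to the product of the
integrals. -/
theorem lintegral_prod_fin_eq_prod_lintegral (n : ℕ) (f : Fin n → ℝ → ℝ≥0∞)
    (hf : ∀ i, Measurable (f i)) :
    ∫⁻ x : Fin n → ℝ, ∏ i, f i (x i) = ∏ i, ∫⁻ t, f i t := by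
  induction n with
  | zero => simp [volume_pi]
  | succ n ih =>
    have hm := (volume_preserving_piFinSuccAbove (fun _ : Fin (n + 1) => ℝ) 0).symm
    have hfm : Measurable fun x : Fin (n + 1) → ℝ => ∏ i, f i (x i) :=
      Finset.measurable_prod _ fun i _ => (hf i).comp (measurable_pi_apply i)
    rw [← hm.lintegral_comp hfm, Fin.prod_univ_succ, ← ih _ fun i => hf i.succ]
    simp only [Fin.prod_univ_succ]
    change ∫⁻ a : ℝ × (Fin n → ℝ), f 0 ((Fin.insertNth 0 a.1 a.2 : Fin (n+1) → ℝ) 0) *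
      ∏ i : Fin n, f i.succ ((Fin.insertNth 0 a.1 a.2 : Fin (n+1) → ℝ) i.succ) = _
    simp only [Fin.insertNth_zero, Fin.cons_zero, Fin.cons_succ]
    exact lintegral_prod_mul (μ := volume) (ν := volume) (f := f 0)
      (g := fun x : Fin n → ℝ => ∏ i, f i.succ (x i)) (hf 0).aemeasurable
      (Finset.measurable_prod _ fun i _ =>
        (hf i.succ).comp (measurable_pi_apply i)).aemeasurable

/-- A product of nonnegative functions of the coordinates of a point of `ℝᵈ` integrates to the
product of the integrals. -/
theorem lintegral_euclidean_prod (d : ℕ) (f : Fin d → ℝ → ℝ≥0∞) (hf : ∀ i, Measurable (f i)) :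
    ∫⁻ x : EuclideanSpace ℝ (Fin d), ∏ i, f i (x i) = ∏ i, ∫⁻ t, f i t := by
  rw [← lintegral_prod_fin_eq_prod_lintegral d f hf]
  exact (PiLp.volume_preserving_ofLp (Fin d)).lintegral_comp
    (f := fun x : Fin d → ℝ => ∏ i, f i (x i))
    (Finset.measurable_prod _ fun i _ => (hf i).comp (measurable_pi_apply i))

/-- `g` may change sign: the pointwise lower bounds integrated later are negative where the
oscillation nearly vanishes. -/
theorem ofReal_integral_le_lintegral_ofReal {α : Type*} [MeasurableSpace α] {μ : Measure α}
    {g : α → ℝ} (hg : Integrable g μ) :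
    ENNReal.ofReal (∫ x, g x ∂μ) ≤ ∫⁻ x, ENNReal.ofReal (g x) ∂μ := by
  calc ENNReal.ofReal (∫ x, g x ∂μ) ≤ ENNReal.ofReal (∫ x, max (g x) 0 ∂μ) :=
        ENNReal.ofReal_le_ofReal
          (integral_mono hg hg.pos_part fun x => le_max_left _ _)
    _ = ∫⁻ x, ENNReal.ofReal (max (g x) 0) ∂μ :=
        ofReal_integral_eq_lintegral_ofReal hg.pos_part (.of_forall fun x => le_max_right _ _)
    _ = ∫⁻ x, ENNReal.ofReal (g x) ∂μ := by simp

/-! ### The one-dimensional flow and its Hellinger affinity -/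

/-- The one-dimensional potential `x² / 2 - cos (L x) / (2 L²)`. -/
noncomputable def coordPotential (L x : ℝ) : ℝ := x ^ 2 / 2 - Real.cos (L * x) / (2 * L ^ 2)

/-- The derivative of `coordPotential`. -/
noncomputable def coordForce (L x : ℝ) : ℝ := x + Real.sin (L * x) / (2 * L)

/-- The normalizing constant of the density proportional to `exp (-coordPotential L)`. -/
noncomputable def coordNormalizer (L : ℝ) : ℝ := ∫ x, Real.exp (-coordPotential L x)

/-- The joint density at `(x, y)` of a point drawn from the one-dimensional target and a Langevin
proposal made from it. -/
noncomputable def coordFlow (L h x y : ℝ) : ℝ :=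
  Real.exp (-coordPotential L x) / coordNormalizer L *
    (1 / (4 * Real.pi * h) ^ ((1 : ℝ) / 2) *
      Real.exp (-(y - x + h * coordForce L x) ^ 2 / (4 * h)))

/-- The Hellinger affinity between the joint density `coordFlow` and its reversal. -/
noncomputable def coordAffinity (L h : ℝ) : ℝ≥0∞ :=
  ∫⁻ x, ∫⁻ y, ENNReal.ofReal (√(coordFlow L h x y) * √(coordFlow L h y x))

@[fun_prop]
theorem continuous_coordPotential (L : ℝ) : Continuous (coordPotential L) := by
  unfold coordPotential; fun_prop

@[fun_prop]
theorem continuous_coordForce (L : ℝ) : Continuous (coordForce L) := by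
  unfold coordForce; fun_prop

theorem hasDerivAt_coordPotential {L : ℝ} (hL : L ≠ 0) (x : ℝ) :
    HasDerivAt (coordPotential L) (coordForce L x) x := by
  have h1 : HasDerivAt (fun x : ℝ => x ^ 2 / 2) x x := by
    exact ((hasDerivAt_pow 2 x).div_const 2).congr_deriv (by simp)
  have h2 : HasDerivAt (fun x : ℝ => Real.cos (L * x) / (2 * L ^ 2))
      (-Real.sin (L * x) * L / (2 * L ^ 2)) x := by
    have h3 : HasDerivAt (fun x : ℝ => L * x) L x := by
      simpa using (hasDerivAt_id x).const_mul L
    exact (h3.cos).div_const _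
  exact (h1.sub h2).congr_deriv (by unfold coordForce; field_simp; ring)

/-- Comparison with a Gaussian uniformly in `L`; this keeps the final constants independent of the
dimension. -/
theorem abs_coordPotential_sub_le {L : ℝ} (hL : 1 ≤ L) (x : ℝ) :
    |coordPotential L x - x ^ 2 / 2| ≤ 1 / 2 := by
  unfold coordPotential
  rw [show x ^ 2 / 2 - Real.cos (L * x) / (2 * L ^ 2) - x ^ 2 / 2
    = -(Real.cos (L * x) / (2 * L ^ 2)) by ring, abs_neg, abs_div,
    abs_of_pos (by positivity : 0 < 2 * L ^ 2), div_le_iff₀ (by positivity)]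
  nlinarith [Real.abs_cos_le_one (L * x)]

theorem integrable_exp_neg_half_sq : Integrable fun x : ℝ => Real.exp (1 / 2 - x ^ 2 / 2) := by
  have := (integrable_exp_neg_mul_sq (b := 1 / 2) (by norm_num)).const_mul (Real.exp (1 / 2))
  refine this.congr (.of_forall fun x => ?_)
  simp only [← Real.exp_add]
  congr 1; ring

theorem integrable_exp_neg_coordPotential {L : ℝ} (hL : 1 ≤ L) :
    Integrable fun x => Real.exp (-coordPotential L x) := by
  refine integrable_exp_neg_half_sq.mono' (by fun_prop) (.of_forall fun x => ?_)
  rw [Real.norm_of_nonneg (Real.exp_pos _).le]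
  have := abs_le.1 (abs_coordPotential_sub_le hL x)
  exact Real.exp_le_exp.2 (by linarith)

theorem coordNormalizer_pos {L : ℝ} (hL : 1 ≤ L) : 0 < coordNormalizer L :=
  integral_exp_pos (integrable_exp_neg_coordPotential hL)

/-- A bound on `coordNormalizer` independent of `L`. -/
theorem coordNormalizer_le {L : ℝ} (hL : 1 ≤ L) :
    coordNormalizer L ≤ ∫ x : ℝ, Real.exp (1 / 2 - x ^ 2 / 2) := by
  refine integral_mono (integrable_exp_neg_coordPotential hL) integrable_exp_neg_half_sq
    fun x => ?_
  have := abs_le.1 (abs_coordPotential_sub_le hL x)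
  exact Real.exp_le_exp.2 (by linarith)

theorem coordFlow_pos {L h : ℝ} (hL : 1 ≤ L) (hh : 0 < h) (x y : ℝ) : 0 < coordFlow L h x y := by
  have := coordNormalizer_pos hL
  unfold coordFlow; positivity

theorem continuous_coordFlow (L h : ℝ) : Continuous fun z : ℝ × ℝ => coordFlow L h z.1 z.2 := by
  unfold coordFlow; fun_prop

@[fun_prop]
theorem continuous_coordFlow_comp {α : Type*} [TopologicalSpace α] (L h : ℝ) {f g : α → ℝ}
    (hf : Continuous f) (hg : Continuous g) : Continuous fun z => coordFlow L h (f z) (g z) :=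
  (continuous_coordFlow L h).comp (hf.prodMk hg)

theorem lintegral_exp_neg_coordPotential {L : ℝ} (hL : 1 ≤ L) :
    ∫⁻ x, ENNReal.ofReal (Real.exp (-coordPotential L x) / coordNormalizer L) = 1 := by
  rw [← ofReal_integral_eq_lintegral_ofReal
    ((integrable_exp_neg_coordPotential hL).div_const _)
    (.of_forall fun x => (div_pos (Real.exp_pos _) (coordNormalizer_pos hL)).le),
    integral_div, ← coordNormalizer, div_self (coordNormalizer_pos hL).ne', ENNReal.ofReal_one]

theorem lintegral_langevin_proposal {h : ℝ} (hh : 0 < h) (a b : ℝ) :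
    ∫⁻ y, ENNReal.ofReal (1 / (4 * Real.pi * h) ^ ((1 : ℝ) / 2) *
      Real.exp (-(y - a + b) ^ 2 / (4 * h))) = 1 := by
  have := ProbabilityTheory.lintegral_gaussianPDFReal_eq_one (a - b) (v := ⟨2 * h, by positivity⟩)
    (fun h0 => (by positivity : (2 * h : ℝ) ≠ 0) (congrArg NNReal.toReal h0))
  rw [← this]
  refine lintegral_congr fun y => ?_
  rw [← Real.sqrt_eq_rpow, one_div]
  change _ = ENNReal.ofReal ((√(2 * Real.pi * (2 * h)))⁻¹ *
    Real.exp (-(y - (a - b)) ^ 2 / (2 * (2 * h))))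
  rw [show 2 * Real.pi * (2 * h) = 4 * Real.pi * h by ring, show 2 * (2 * h) = 4 * h by ring,
    show y - (a - b) = y - a + b by ring]

theorem lintegral_coordFlow {L h : ℝ} (hL : 1 ≤ L) (hh : 0 < h) :
    ∫⁻ x, ∫⁻ y, ENNReal.ofReal (coordFlow L h x y) = 1 := by
  rw [← lintegral_exp_neg_coordPotential hL]
  refine lintegral_congr fun x => ?_
  unfold coordFlow
  simp_rw [ENNReal.ofReal_mul (div_pos (Real.exp_pos (-coordPotential L x))
    (coordNormalizer_pos hL)).le]
  rw [lintegral_const_mul _ (by fun_prop), lintegral_langevin_proposal hh, mul_one]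

/-- The squared Hellinger distance between `coordFlow` and its reversal, in terms of the affinity. -/
theorem two_mul_coordAffinity_add {L h : ℝ} (hL : 1 ≤ L) (hh : 0 < h) :
    2 * coordAffinity L h +
      ∫⁻ x, ∫⁻ y, ENNReal.ofReal ((√(coordFlow L h x y) - √(coordFlow L h y x)) ^ 2) = 2 := by
  have hswap : ∫⁻ x, ∫⁻ y, ENNReal.ofReal (coordFlow L h y x) = 1 := by
    rw [lintegral_lintegral_swap (by unfold Function.uncurry; fun_prop), lintegral_coordFlow hL hh]
  have h2 : (2 : ℝ≥0∞) = ∫⁻ x, ∫⁻ y, ENNReal.ofReal (coordFlow L h x y) +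
      ENNReal.ofReal (coordFlow L h y x) := by
    have h3 : Measurable fun x => ∫⁻ y, ENNReal.ofReal (coordFlow L h x y) :=
      Measurable.lintegral_prod_right'
        (f := fun z : ℝ × ℝ => ENNReal.ofReal (coordFlow L h z.1 z.2)) (by fun_prop)
    simp_rw [fun x => lintegral_add_left (μ := volume)
      (f := fun y => ENNReal.ofReal (coordFlow L h x y)) (by fun_prop)
      fun y => ENNReal.ofReal (coordFlow L h y x)]
    rw [lintegral_add_left h3, hswap, lintegral_coordFlow hL hh, one_add_one_eq_two]
  have h4 : Measurable fun x =>
      ∫⁻ y, ENNReal.ofReal (√(coordFlow L h x y) * √(coordFlow L h y x)) :=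
    Measurable.lintegral_prod_right'
      (f := fun z : ℝ × ℝ => ENNReal.ofReal (√(coordFlow L h z.1 z.2) * √(coordFlow L h z.2 z.1)))
      (by fun_prop)
  conv_rhs => rw [h2]
  rw [coordAffinity, ← lintegral_const_mul _ h4, ← lintegral_add_left (h4.const_mul _)]
  refine lintegral_congr fun x => ?_
  rw [← lintegral_const_mul _ (by fun_prop), ← lintegral_add_left (by fun_prop)]
  refine lintegral_congr fun y => ?_
  have ha := (coordFlow_pos hL hh x y).le
  have hb := (coordFlow_pos hL hh y x).le
  rw [← ENNReal.ofReal_add ha hb, show (2 : ℝ≥0∞) = ENNReal.ofReal 2 by simp,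
    ← ENNReal.ofReal_mul (by norm_num), ← ENNReal.ofReal_add (by positivity) (by positivity)]
  congr 1
  nlinarith [Real.sq_sqrt ha, Real.sq_sqrt hb]

/-! ### The log-ratio of the reversed flow -/

/-- The logarithm of the ratio between the reversal of `coordFlow` and `coordFlow`. -/
noncomputable def coordLogRatio (L h x y : ℝ) : ℝ :=
  (Real.cos (L * y) - Real.cos (L * x)) / (2 * L ^ 2) +
    (y - x) / (4 * L) * (Real.sin (L * x) + Real.sin (L * y)) +
    h / 4 * (coordForce L x ^ 2 - coordForce L y ^ 2)

/-- Expanding the Gaussian exponent, the terms `(y - x)² / (4h)` are symmetric and cancel. What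
remains is `V(x) - V(y) + (y - x)(V'(x) + V'(y)) / 2` plus the drift correction, and the quadratic
part of `V` drops out of the former. -/
theorem coordFlow_swap {L h : ℝ} (hL : L ≠ 0) (hh : h ≠ 0) (x y : ℝ) :
    coordFlow L h y x = coordFlow L h x y * Real.exp (coordLogRatio L h x y) := by
  have key : -coordPotential L y + -(x - y + h * coordForce L y) ^ 2 / (4 * h) =
      -coordPotential L x + -(y - x + h * coordForce L x) ^ 2 / (4 * h) +
        coordLogRatio L h x y := by
    have e1 : ∀ a b F : ℝ, (b - a + h * F) ^ 2 / (4 * h) =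
        (b - a) ^ 2 / (4 * h) + (b - a) * F / 2 + h / 4 * F ^ 2 := by
      intro a b F; field_simp; ring
    rw [neg_div, neg_div, e1, e1]
    unfold coordLogRatio coordPotential coordForce
    field_simp
    ring
  have e2 : ∀ a b : ℝ, coordFlow L h a b =
      1 / coordNormalizer L * (1 / (4 * Real.pi * h) ^ ((1 : ℝ) / 2)) *
        Real.exp (-coordPotential L a + -(b - a + h * coordForce L a) ^ 2 / (4 * h)) := by
    intro a b; rw [Real.exp_add, coordFlow]; ring
  rw [e2, e2, key, Real.exp_add]
  ring

/-- A lower bound on `t` is needed because `1 - exp t` stays bounded as `t → -∞`. -/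
theorem sq_le_four_mul_exp_sub_one_sq {t : ℝ} (ht : -1 ≤ t) :
    t ^ 2 ≤ 4 * (1 - Real.exp t) ^ 2 := by
  rcases le_or_gt 0 t with h0 | h0
  · nlinarith [Real.add_one_le_exp t]
  · have h1 : Real.exp t * (1 - t) ≤ 1 := by
      have h2 := Real.add_one_le_exp (-t)
      have h3 : Real.exp t * Real.exp (-t) = 1 := by rw [← Real.exp_add]; simp
      nlinarith [Real.exp_pos t]
    have h4 : -t / 2 ≤ 1 - Real.exp t := by
      have : -t / 2 * (1 - t) ≤ (1 - Real.exp t) * (1 - t) := by nlinarith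
      exact le_of_mul_le_mul_right this (by linarith)
    nlinarith

/-- The square roots differ by the factor `exp (ξ / 2)`, with `ξ` the log-ratio; linearizing at `t =
ξ / 2` gives `1 / 16 = 1 / 4 · 1 / 4`. -/
theorem coordFlow_mul_sq_le {L h : ℝ} (hL : 1 ≤ L) (hh : 0 < h) {x y : ℝ}
    (hxy : -2 ≤ coordLogRatio L h x y) :
    coordFlow L h x y * (coordLogRatio L h x y ^ 2 / 16) ≤
      (√(coordFlow L h x y) - √(coordFlow L h y x)) ^ 2 := by
  have ha := (coordFlow_pos hL hh x y).le
  set ξ := coordLogRatio L h x y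
  have h1 : √(coordFlow L h y x) = √(coordFlow L h x y) * Real.exp (ξ / 2) := by
    rw [coordFlow_swap (by positivity) hh.ne' x y, Real.sqrt_mul ha, Real.exp_half]
  have h2 := sq_le_four_mul_exp_sub_one_sq (t := ξ / 2) (by linarith)
  rw [h1, show (√(coordFlow L h x y) - √(coordFlow L h x y) * Real.exp (ξ / 2)) ^ 2 =
    √(coordFlow L h x y) ^ 2 * (1 - Real.exp (ξ / 2)) ^ 2 by ring, Real.sq_sqrt ha]
  exact mul_le_mul_of_nonneg_left (by linarith) ha

/-! ### Lower bound on the Hellinger distance at high frequency -/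

section LargeFrequency

variable {L s x u : ℝ} (hL : 2 ≤ L) (hs : 0 < s) (hLs : 32 ≤ L * s) (hsL : s ^ 2 * L ≤ 1 / 128)
  (hx0 : 0 ≤ x) (hx1 : x ≤ 1) (hu0 : s ≤ u) (hu1 : u ≤ 2 * s)

include hL hsL in
theorem step_le : s ≤ 1 / 16 := by
  have : s ^ 2 ≤ (1 / 16) ^ 2 := by nlinarith
  exact le_of_sq_le_sq this (by norm_num)

include hL hs hLs hsL hx0 hx1 hu0 hu1 in
-- The sum of sines becomes a product separating the phase in `x` from a factor in `u` alone. The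
-- cosine terms are absorbed through `32 ≤ L * s`, the drift correction through `s ^ 2 * L ≤ 1 /
-- 128`.
theorem abs_coordLogRatio_sub_le :
    |coordLogRatio L (s ^ 2) x (x + u) -
      u / (2 * L) * (Real.sin (L * x + L / 2 * u) * Real.cos (L / 2 * u))| ≤ s / L / 16 := by
  have hL0 : 0 < L := by linarith
  have hs1 := step_le hL hsL
  have hmain : (x + u - x) / (4 * L) * (Real.sin (L * x) + Real.sin (L * (x + u))) =
      u / (2 * L) * (Real.sin (L * x + L / 2 * u) * Real.cos (L / 2 * u)) := by
    have h1 : ∀ a b : ℝ, Real.sin (a - b) + Real.sin (a + b) = 2 * (Real.sin a * Real.cos b) := by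
      intro a b; rw [Real.sin_sub, Real.sin_add]; ring
    have h2 := h1 (L * x + L / 2 * u) (L / 2 * u)
    rw [show L * x + L / 2 * u - L / 2 * u = L * x by ring,
      show L * x + L / 2 * u + L / 2 * u = L * (x + u) by ring] at h2
    rw [h2]
    field_simp
    ring
  have hinv : 1 / L ≤ s / 32 := by rw [div_le_div_iff₀ hL0 (by norm_num)]; linarith
  have he1 : |(Real.cos (L * (x + u)) - Real.cos (L * x)) / (2 * L ^ 2)| ≤ s / L / 32 := by
    have h1 : |Real.cos (L * (x + u)) - Real.cos (L * x)| ≤ 2 := by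
      refine (abs_sub _ _).trans ?_
      linarith [Real.abs_cos_le_one (L * (x + u)), Real.abs_cos_le_one (L * x)]
    rw [abs_div, abs_of_pos (by positivity : 0 < 2 * L ^ 2), div_le_iff₀ (by positivity)]
    have : s / L / 32 * (2 * L ^ 2) = L * s / 16 := by field_simp; ring
    linarith
  have hsin : ∀ a, |Real.sin a / (2 * L)| ≤ s / 64 := by
    intro a
    rw [abs_div, abs_of_pos (by positivity : 0 < 2 * L)]
    calc |Real.sin a| / (2 * L) ≤ 1 / (2 * L) := by
          gcongr; exact Real.abs_sin_le_one a
      _ = 1 / L / 2 := by field_simp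
      _ ≤ s / 64 := by linarith
  have he2 : |s ^ 2 / 4 * (coordForce L x ^ 2 - coordForce L (x + u) ^ 2)| ≤ s / L / 40 := by
    have a1 := abs_le.1 (hsin (L * x))
    have a2 := abs_le.1 (hsin (L * (x + u)))
    have h1 : |coordForce L x + coordForce L (x + u)| ≤ 3 := by
      unfold coordForce; rw [abs_le]; constructor <;> linarith
    have h2 : |coordForce L x - coordForce L (x + u)| ≤ 3 * s := by
      unfold coordForce; rw [abs_le]; constructor <;> linarith
    rw [sq_sub_sq, abs_mul, abs_mul, abs_of_pos (by positivity : 0 < s ^ 2 / 4)]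
    calc s ^ 2 / 4 * (|coordForce L x + coordForce L (x + u)| *
          |coordForce L x - coordForce L (x + u)|) ≤ s ^ 2 / 4 * (3 * (3 * s)) := by gcongr
      _ = (s ^ 2 * L) * (9 / 4) * (s / L) := by field_simp; ring
      _ ≤ 1 / 128 * (9 / 4) * (s / L) := by gcongr
      _ ≤ s / L / 40 := by
        have : 0 < s / L := by positivity
        linarith
  unfold coordLogRatio
  rw [hmain]
  have : 0 < s / L := by positivity
  rw [abs_le] at he1 he2 ⊢
  constructor <;> linarith

include hL hs hLs hsL hx0 hx1 hu0 hu1 in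
theorem neg_two_le_coordLogRatio : -2 ≤ coordLogRatio L (s ^ 2) x (x + u) := by
  have h1 := abs_le.1 (abs_coordLogRatio_sub_le hL hs hLs hsL hx0 hx1 hu0 hu1)
  have hs1 := step_le hL hsL
  have h2 : |u / (2 * L) * (Real.sin (L * x + L / 2 * u) * Real.cos (L / 2 * u))| ≤ s / L := by
    rw [abs_mul, abs_mul, abs_of_nonneg (div_nonneg (by linarith) (by linarith))]
    calc u / (2 * L) * (|Real.sin (L * x + L / 2 * u)| * |Real.cos (L / 2 * u)|)
        ≤ (2 * s) / (2 * L) * (1 * 1) := by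
          gcongr
          · exact Real.abs_sin_le_one _
          · exact Real.abs_cos_le_one _
      _ = s / L := by field_simp
  have h3 : s / L ≤ 1 := by rw [div_le_one (by linarith)]; linarith
  have := abs_le.1 h2
  linarith

include hL hs hLs hsL hx0 hx1 hu0 hu1 in
-- With `m` the main term, `ξ² ≥ m² / 2 - (ξ - m)²`, where `u ≥ s` bounds `m²` from below and the
-- error is at most `s / L / 16`.
theorem le_coordLogRatio_sq :
    s ^ 2 / L ^ 2 * (Real.cos (L / 2 * u) ^ 2 * Real.sin (L * x + L / 2 * u) ^ 2 / 8 - 1 / 256) ≤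
      coordLogRatio L (s ^ 2) x (x + u) ^ 2 := by
  have h1 := abs_coordLogRatio_sub_le hL hs hLs hsL hx0 hx1 hu0 hu1
  have hL0 : 0 < L := by linarith
  have hr : 0 ≤ s / L / 16 := by positivity
  set ξ := coordLogRatio L (s ^ 2) x (x + u)
  set S := Real.sin (L * x + L / 2 * u)
  set C := Real.cos (L / 2 * u)
  set m := u / (2 * L) * (S * C) with hm
  have h2 : (ξ - m) ^ 2 ≤ (s / L / 16) ^ 2 := sq_le_sq.2 (by rwa [abs_of_nonneg hr])
  have h3 : s ^ 2 / L ^ 2 * (C ^ 2 * S ^ 2 / 4) ≤ m ^ 2 := by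
    rw [show m ^ 2 = u ^ 2 / L ^ 2 * (C ^ 2 * S ^ 2 / 4) by rw [hm]; field_simp; ring]
    gcongr
  have h4 : (s / L / 16) ^ 2 = s ^ 2 / L ^ 2 * (1 / 256) := by field_simp; norm_num
  nlinarith [sq_nonneg (2 * ξ - m)]

/-- A constant bounding from below the one-dimensional flow of steps of the typical size. -/
noncomputable def flowConstant : ℝ :=
  Real.exp (-1) / (∫ x : ℝ, Real.exp (1 / 2 - x ^ 2 / 2)) *
    (1 / (4 * Real.pi) ^ ((1 : ℝ) / 2) * Real.exp (-4))

theorem flowConstant_pos : 0 < flowConstant := by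
  have := integral_exp_pos integrable_exp_neg_half_sq
  unfold flowConstant; positivity

include hL hs hsL hx0 hx1 hu0 hu1 in
-- The drift moves the mean by at most `2 s² ≤ s`, so a step of length at most `2 s` lies within a
-- bounded number of standard deviations and the density is of order `1 / s`.
theorem flowConstant_div_le_coordFlow : flowConstant / s ≤ coordFlow L (s ^ 2) x (x + u) := by
  have hL1 : 1 ≤ L := by linarith
  have hs1 := step_le hL hsL
  have hZ := coordNormalizer_pos hL1
  have hZ' := coordNormalizer_le hL1
  have h1 : (4 * Real.pi * s ^ 2) ^ ((1 : ℝ) / 2) = (4 * Real.pi) ^ ((1 : ℝ) / 2) * s := by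
    rw [Real.mul_rpow (by positivity) (by positivity), ← Real.sqrt_eq_rpow (s ^ 2),
      Real.sqrt_sq hs.le]
  have h2 : coordPotential L x ≤ 1 := by
    have := abs_le.1 (abs_coordPotential_sub_le hL1 x)
    nlinarith
  have h3 : |coordForce L x| ≤ 2 := by
    have h4 : |Real.sin (L * x) / (2 * L)| ≤ 1 := by
      rw [abs_div, abs_of_pos (by positivity : 0 < 2 * L), div_le_one (by positivity)]
      linarith [Real.abs_sin_le_one (L * x)]
    unfold coordForce
    rw [abs_le] at h4 ⊢
    constructor <;> linarith
  have h5 : (x + u - x + s ^ 2 * coordForce L x) ^ 2 ≤ (4 * s) ^ 2 := by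
    rw [abs_le] at h3
    refine sq_le_sq.2 ?_
    rw [abs_of_pos (by positivity : 0 < 4 * s), abs_le]
    constructor <;> nlinarith
  have h6 : (x + u - x + s ^ 2 * coordForce L x) ^ 2 / (4 * s ^ 2) ≤ 4 := by
    rw [div_le_iff₀ (by positivity)]; linarith
  have h7 : flowConstant / s = Real.exp (-1) / (∫ x : ℝ, Real.exp (1 / 2 - x ^ 2 / 2)) *
    (1 / ((4 * Real.pi) ^ ((1 : ℝ) / 2) * s) * Real.exp (-4)) := by
    unfold flowConstant; field_simp
  rw [h7, coordFlow, h1, neg_div]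
  gcongr

include hL in
-- The mean of `sin²` is 1/2, and the boundary terms cost at most `1 / (2L) ≤ 1 / 4`, whatever the
-- phase.
theorem quarter_le_integral_sin_sq (φ : ℝ) :
    1 / 4 ≤ ∫ x in (0 : ℝ)..1, Real.sin (L * x + φ) ^ 2 := by
  have hL0 : 0 < L := by linarith
  rw [intervalIntegral.integral_comp_mul_add (fun t => Real.sin t ^ 2) hL0.ne', integral_sin_sq,
    smul_eq_mul, inv_mul_eq_div, le_div_iff₀ hL0]
  have h1 : ∀ a, |Real.sin a * Real.cos a| ≤ 1 / 2 := by
    intro a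
    rw [abs_le]
    constructor <;> nlinarith [sq_nonneg (Real.sin a + Real.cos a),
      sq_nonneg (Real.sin a - Real.cos a), Real.sin_sq_add_cos_sq a]
  have h2 := abs_le.1 (h1 (L * 0 + φ))
  have h3 := abs_le.1 (h1 (L * 1 + φ))
  linarith

include hL hLs in
theorem quarter_le_integral_cos_sq :
    s / 4 ≤ ∫ u in s..(2 * s), Real.cos (L / 2 * u) ^ 2 := by
  have hL0 : 0 < L / 2 := by linarith
  rw [intervalIntegral.integral_comp_mul_left (fun t => Real.cos t ^ 2) hL0.ne', integral_cos_sq,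
    smul_eq_mul, inv_mul_eq_div, le_div_iff₀ hL0]
  have h1 : ∀ a, |Real.cos a * Real.sin a| ≤ 1 / 2 := by
    intro a
    rw [abs_le]
    constructor <;> nlinarith [sq_nonneg (Real.sin a + Real.cos a),
      sq_nonneg (Real.sin a - Real.cos a), Real.sin_sq_add_cos_sq a]
  have h2 := abs_le.1 (h1 (L / 2 * s))
  have h3 := abs_le.1 (h1 (L / 2 * (2 * s)))
  nlinarith

include hL hs hLs hsL in
/-- A lower bound for the squared Hellinger distance between `coordFlow` and its reversal. -/
theorem le_lintegral_sqrt_coordFlow_sub_sq :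
    ENNReal.ofReal (flowConstant / 4096 * (s ^ 2 / L ^ 2)) ≤
      ∫⁻ x, ∫⁻ y,
        ENNReal.ofReal ((√(coordFlow L (s ^ 2) x y) - √(coordFlow L (s ^ 2) y x)) ^ 2) := by
  have hL1 : 1 ≤ L := by linarith
  have hK := flowConstant_pos
  have hh : 0 < s ^ 2 := by positivity
  set G : ℝ → ℝ → ℝ := fun x y =>
    (√(coordFlow L (s ^ 2) x y) - √(coordFlow L (s ^ 2) y x)) ^ 2
  -- Density bound `flowConstant / s`, times `1 / 16` from linearizing the exponential, times the
  -- squared size `s² / L²` of the oscillation.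
  set B : ℝ := flowConstant / s / 16 * (s ^ 2 / L ^ 2) with hB
  have hB0 : 0 ≤ B := by positivity
  set C : ℝ → ℝ := fun u => Real.cos (L / 2 * u) ^ 2
  have hpt : ∀ u ∈ Set.Ioc s (2 * s), ∀ x ∈ Set.Ioc (0 : ℝ) 1,
      B * (C u * Real.sin (L * x + L / 2 * u) ^ 2 / 8 - 1 / 256) ≤ G x (x + u) := by
    intro u hu x hx
    have h1 := coordFlow_mul_sq_le hL1 hh
      (neg_two_le_coordLogRatio hL hs hLs hsL hx.1.le hx.2 hu.1.le hu.2)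
    have h2 := le_coordLogRatio_sq hL hs hLs hsL hx.1.le hx.2 hu.1.le hu.2
    have h3 := flowConstant_div_le_coordFlow hL hs hsL hx.1.le hx.2 hu.1.le hu.2
    refine le_trans ?_ h1
    calc B * (C u * Real.sin (L * x + L / 2 * u) ^ 2 / 8 - 1 / 256)
        = flowConstant / s * ((s ^ 2 / L ^ 2 *
          (C u * Real.sin (L * x + L / 2 * u) ^ 2 / 8 - 1 / 256)) / 16) := by rw [hB]; ring
      _ ≤ flowConstant / s * (coordLogRatio L (s ^ 2) x (x + u) ^ 2 / 16) := by gcongr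
      _ ≤ _ := by gcongr
  have hinner : ∀ u ∈ Set.Ioc s (2 * s), ENNReal.ofReal (B * (C u / 32 - 1 / 256)) ≤
      ∫⁻ x, ENNReal.ofReal (G x (x + u)) := by
    intro u hu
    have hint : Continuous fun x : ℝ =>
      B * (C u * Real.sin (L * x + L / 2 * u) ^ 2 / 8 - 1 / 256) := by fun_prop
    calc ENNReal.ofReal (B * (C u / 32 - 1 / 256))
        ≤ ENNReal.ofReal (∫ x in Set.Ioc (0 : ℝ) 1,
          B * (C u * Real.sin (L * x + L / 2 * u) ^ 2 / 8 - 1 / 256)) := by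
          refine ENNReal.ofReal_le_ofReal ?_
          rw [← intervalIntegral.integral_of_le zero_le_one, intervalIntegral.integral_const_mul,
            intervalIntegral.integral_sub
              (Continuous.intervalIntegrable (by fun_prop) _ _)
              (Continuous.intervalIntegrable (by fun_prop) _ _),
            intervalIntegral.integral_div, intervalIntegral.integral_const_mul,
            intervalIntegral.integral_const]
          have h1 := quarter_le_integral_sin_sq hL (L / 2 * u)
          have h2 : 0 ≤ C u := sq_nonneg _
          refine mul_le_mul_of_nonneg_left ?_ hB0
          rw [smul_eq_mul]
          nlinarith
      _ ≤ ∫⁻ x in Set.Ioc (0 : ℝ) 1,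
          ENNReal.ofReal (B * (C u * Real.sin (L * x + L / 2 * u) ^ 2 / 8 - 1 / 256)) :=
          ofReal_integral_le_lintegral_ofReal (hint.integrableOn_Ioc)
      _ ≤ ∫⁻ x in Set.Ioc (0 : ℝ) 1, ENNReal.ofReal (G x (x + u)) :=
          setLIntegral_mono' measurableSet_Ioc fun x hx => ENNReal.ofReal_le_ofReal (hpt u hu x hx)
      _ ≤ _ := setLIntegral_le_lintegral _ _
  have hintC : Continuous fun u : ℝ => B * (C u / 32 - 1 / 256) := by fun_prop
  calc ENNReal.ofReal (flowConstant / 4096 * (s ^ 2 / L ^ 2))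
      ≤ ENNReal.ofReal (∫ u in Set.Ioc s (2 * s), B * (C u / 32 - 1 / 256)) := by
        refine ENNReal.ofReal_le_ofReal ?_
        rw [← intervalIntegral.integral_of_le (by linarith), intervalIntegral.integral_const_mul,
          intervalIntegral.integral_sub
            (Continuous.intervalIntegrable (by fun_prop) _ _)
            (Continuous.intervalIntegrable (by fun_prop) _ _),
          intervalIntegral.integral_div, intervalIntegral.integral_const]
        have h1 := quarter_le_integral_cos_sq (s := s) hL hLs
        -- The averaged oscillation `s / 128` exceeds the error `s / 256` by `s / 256`, and `16 ·
        -- 256 = 4096`.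
        calc flowConstant / 4096 * (s ^ 2 / L ^ 2) = B * (s / 4 / 32 - s / 256) := by
              rw [hB]; field_simp; norm_num
          _ ≤ _ := by
              refine mul_le_mul_of_nonneg_left ?_ hB0
              rw [smul_eq_mul]
              linarith
    _ ≤ ∫⁻ u in Set.Ioc s (2 * s), ENNReal.ofReal (B * (C u / 32 - 1 / 256)) :=
        ofReal_integral_le_lintegral_ofReal hintC.integrableOn_Ioc
    _ ≤ ∫⁻ u in Set.Ioc s (2 * s), ∫⁻ x, ENNReal.ofReal (G x (x + u)) :=
        setLIntegral_mono' measurableSet_Ioc hinner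
    _ ≤ ∫⁻ u, ∫⁻ x, ENNReal.ofReal (G x (x + u)) := setLIntegral_le_lintegral _ _
    _ = ∫⁻ x, ∫⁻ u, ENNReal.ofReal (G x (x + u)) :=
        lintegral_lintegral_swap (by unfold Function.uncurry; fun_prop)
    _ = ∫⁻ x, ∫⁻ y, ENNReal.ofReal (G x y) := by
        refine lintegral_congr fun x => ?_
        exact lintegral_add_left_eq_self (fun y => ENNReal.ofReal (G x y)) x

end LargeFrequency

/-! ### Upper bounds on the one-dimensional affinity -/

theorem coordAffinity_le_one {L h : ℝ} (hL : 1 ≤ L) (hh : 0 < h) : coordAffinity L h ≤ 1 := by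
  have h1 : 2 * coordAffinity L h ≤ 2 * 1 := by
    rw [mul_one]
    exact le_self_add.trans (two_mul_coordAffinity_add hL hh).le
  exact (ENNReal.mul_le_mul_iff_right (by norm_num) (by norm_num)).1 h1

/-- The affinity equals `1 - H² / 2 ≤ exp (-H² / 2)`, a form suited to taking the `d`-th power;
halving turns 4096 into 8192. -/
theorem coordAffinity_le {L s : ℝ} (hL : 2 ≤ L) (hs : 0 < s) (hLs : 32 ≤ L * s)
    (hsL : s ^ 2 * L ≤ 1 / 128) :
    coordAffinity L (s ^ 2) ≤
      ENNReal.ofReal (Real.exp (-(flowConstant / 8192 * (s ^ 2 / L ^ 2)))) := by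
  have hh : 0 < s ^ 2 := by positivity
  have hL1 : 1 ≤ L := by linarith
  have hK := flowConstant_pos
  have h1 := two_mul_coordAffinity_add hL1 hh
  have h2 := le_lintegral_sqrt_coordFlow_sub_sq hL hs hLs hsL
  have h3 := coordAffinity_le_one hL1 hh
  have h4 : coordAffinity L (s ^ 2) ≠ ∞ := (h3.trans_lt ENNReal.one_lt_top).ne
  obtain ⟨r, hr⟩ : ∃ r : NNReal, coordAffinity L (s ^ 2) = r := ⟨_, (ENNReal.coe_toNNReal h4).symm⟩
  have h5 : ENNReal.ofReal (2 * r + flowConstant / 4096 * (s ^ 2 / L ^ 2)) ≤ ENNReal.ofReal 2 := by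
    rw [ENNReal.ofReal_add (by positivity) (by positivity), ENNReal.ofReal_mul (by norm_num),
      ENNReal.ofReal_coe_nnreal, ← hr, ENNReal.ofReal_ofNat]
    exact (add_le_add_right h2 _).trans h1.le
  rw [ENNReal.ofReal_le_ofReal_iff (by norm_num)] at h5
  rw [hr, ← ENNReal.ofReal_coe_nnreal]
  refine ENNReal.ofReal_le_ofReal ?_
  have := Real.add_one_le_exp (-(flowConstant / 8192 * (s ^ 2 / L ^ 2)))
  linarith

/-! ### Product structure of target and flow -/

theorem adversarialPotential_eq_sum (d : ℕ) (η : ℝ) (x : EuclideanSpace ℝ (Fin d)) :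
    adversarialPotential d η x = ∑ i, coordPotential ((d : ℝ) ^ η) (x i) := by
  have h1 : (d : ℝ) ^ (2 * η) = ((d : ℝ) ^ η) ^ 2 := by
    rw [mul_comm, Real.rpow_mul (Nat.cast_nonneg d), Real.rpow_two]
  unfold adversarialPotential coordPotential
  rw [h1, EuclideanSpace.real_norm_sq_eq, Finset.sum_sub_distrib, Finset.sum_div, Finset.mul_sum]
  congr 1
  exact Finset.sum_congr rfl fun i _ => by ring

theorem gradient_sum_coordPotential {L : ℝ} (hL : L ≠ 0) (x : EuclideanSpace ℝ (Fin d)) (i : Fin d) :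
    gradient (fun x : EuclideanSpace ℝ (Fin d) => ∑ i, coordPotential L (x i)) x i =
      coordForce L (x i) := by
  have h1 : HasGradientAt (fun x : EuclideanSpace ℝ (Fin d) => ∑ i, coordPotential L (x i))
      (WithLp.toLp 2 fun i => coordForce L (x i)) x := by
    rw [hasGradientAt_iff_hasFDerivAt]
    have h2 : ∀ i ∈ (Finset.univ : Finset (Fin d)),
        HasFDerivAt (fun x : EuclideanSpace ℝ (Fin d) => coordPotential L (x i))
          (coordForce L (x i) • EuclideanSpace.proj i) x := fun i _ =>
      HasDerivAt.comp_hasFDerivAt (f := fun x : EuclideanSpace ℝ (Fin d) => x i) x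
        (hasDerivAt_coordPotential hL (x i)) (EuclideanSpace.proj (𝕜 := ℝ) i).hasFDerivAt
    refine (HasFDerivAt.fun_sum h2).congr_fderiv ?_
    ext v
    simp [PiLp.inner_apply, mul_comm]
  rw [h1.gradient]

/-- The joint density of a point drawn from the target and a Langevin proposal made from it. -/
noncomputable def flow (V : EuclideanSpace ℝ (Fin d) → ℝ) (h : ℝ)
    (x y : EuclideanSpace ℝ (Fin d)) : ℝ :=
  targetDensity V x * proposalDensity V h x y

theorem targetDensity_sum_coordPotential (L : ℝ) (x : EuclideanSpace ℝ (Fin d)) :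
    targetDensity (fun x : EuclideanSpace ℝ (Fin d) => ∑ i, coordPotential L (x i)) x =
      ∏ i, Real.exp (-coordPotential L (x i)) / coordNormalizer L := by
  have h1 : ∫ z : EuclideanSpace ℝ (Fin d), Real.exp (-∑ i, coordPotential L (z i)) =
      ∏ _i : Fin d, coordNormalizer L := by
    simp_rw [← Finset.sum_neg_distrib, Real.exp_sum]
    unfold coordNormalizer
    rw [← integral_fintype_prod_volume_eq_prod (ι := Fin d)
      (fun _ t => Real.exp (-coordPotential L t))]
    exact (PiLp.volume_preserving_ofLp (Fin d)).integral_comp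
      (MeasurableEquiv.toLp 2 (Fin d → ℝ)).symm.measurableEmbedding
      (fun z : Fin d → ℝ => ∏ i, Real.exp (-coordPotential L (z i)))
  rw [targetDensity, h1, Finset.prod_div_distrib, ← Finset.sum_neg_distrib, Real.exp_sum]

theorem flow_sum_coordPotential {L h : ℝ} (hL : L ≠ 0) (hh : 0 < h)
    (x y : EuclideanSpace ℝ (Fin d)) :
    flow (fun x : EuclideanSpace ℝ (Fin d) => ∑ i, coordPotential L (x i)) h x y =
      ∏ i, coordFlow L h (x i) (y i) := by
  unfold flow coordFlow
  rw [targetDensity_sum_coordPotential, Finset.prod_mul_distrib, proposalDensity,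
    Finset.prod_mul_distrib, ← Real.exp_sum, EuclideanSpace.real_norm_sq_eq]
  congr 2
  · rw [Finset.prod_const, Finset.card_univ, Fintype.card_fin, ← Real.rpow_natCast, one_div,
      one_div, Real.inv_rpow (by positivity), ← Real.rpow_mul (by positivity)]
    congr 2; ring
  · congr 1
    rw [neg_div, Finset.sum_div, ← Finset.sum_neg_distrib]
    refine Finset.sum_congr rfl fun i _ => ?_
    rw [PiLp.add_apply, PiLp.sub_apply, PiLp.smul_apply, gradient_sum_coordPotential hL,
      smul_eq_mul, neg_div]

/-- The Hellinger affinity between the flow of a product target and its reversal is a product. -/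
theorem lintegral_sqrt_flow_mul {L h : ℝ} (hL : 1 ≤ L) (hh : 0 < h) :
    ∫⁻ x, ∫⁻ y, ENNReal.ofReal
      (√(flow (fun x : EuclideanSpace ℝ (Fin d) => ∑ i, coordPotential L (x i)) h x y) *
        √(flow (fun x : EuclideanSpace ℝ (Fin d) => ∑ i, coordPotential L (x i)) h y x)) =
      coordAffinity L h ^ d := by
  have hL0 : L ≠ 0 := by positivity
  have h1 : ∀ x y : EuclideanSpace ℝ (Fin d), ENNReal.ofReal
      (√(flow (fun x : EuclideanSpace ℝ (Fin d) => ∑ i, coordPotential L (x i)) h x y) *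
        √(flow (fun x : EuclideanSpace ℝ (Fin d) => ∑ i, coordPotential L (x i)) h y x)) =
      ∏ i, ENNReal.ofReal (√(coordFlow L h (x i) (y i)) * √(coordFlow L h (y i) (x i))) := by
    intro x y
    rw [flow_sum_coordPotential hL0 hh, flow_sum_coordPotential hL0 hh,
      ← ENNReal.ofReal_prod_of_nonneg fun i _ => by positivity, Finset.prod_mul_distrib,
      Real.sqrt_prod _ fun i _ => (coordFlow_pos hL hh _ _).le,
      Real.sqrt_prod _ fun i _ => (coordFlow_pos hL hh _ _).le]
  simp_rw [h1]
  have h2 : Measurable fun s =>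
      ∫⁻ t, ENNReal.ofReal (√(coordFlow L h s t) * √(coordFlow L h t s)) :=
    Measurable.lintegral_prod_right'
      (f := fun z : ℝ × ℝ => ENNReal.ofReal (√(coordFlow L h z.1 z.2) * √(coordFlow L h z.2 z.1)))
      (by fun_prop)
  have h3 : ∀ x : EuclideanSpace ℝ (Fin d), ∫⁻ y : EuclideanSpace ℝ (Fin d),
      ∏ i, ENNReal.ofReal (√(coordFlow L h (x i) (y i)) * √(coordFlow L h (y i) (x i))) =
      ∏ i, ∫⁻ t, ENNReal.ofReal (√(coordFlow L h (x i) t) * √(coordFlow L h t (x i))) := by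
    intro x
    exact lintegral_euclidean_prod d
      (fun i t => ENNReal.ofReal (√(coordFlow L h (x i) t) * √(coordFlow L h t (x i))))
      fun i => by fun_prop
  simp_rw [h3]
  rw [lintegral_euclidean_prod d (fun _ s => ∫⁻ t, ENNReal.ofReal
    (√(coordFlow L h s t) * √(coordFlow L h t s))) fun _ => h2]
  simp [coordAffinity]

/-! ### From conductance to affinity -/

/-- The flow of the Metropolis-adjusted chain out of a set is at most the Hellinger affinity between
the unadjusted flow and its reversal. -/
theorem lintegral_kernel_compl_le {V : EuclideanSpace ℝ (Fin d) → ℝ} {h : ℝ}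
    (hV : Measurable V) (hpos : ∀ x y, 0 < flow V h x y) {S : Set (EuclideanSpace ℝ (Fin d))}
    (hS : MeasurableSet S) :
    ∫⁻ x in S, kernel V h x Sᶜ ∂target V ≤
      ∫⁻ x, ∫⁻ y, ENNReal.ofReal (√(flow V h x y) * √(flow V h y x)) := by
  have hπ0 : ∀ x, 0 ≤ targetDensity V x := fun x =>
    div_nonneg (Real.exp_pos _).le (integral_nonneg fun _ => (Real.exp_pos _).le)
  have hπm : Measurable fun x => ENNReal.ofReal (targetDensity V x) := by
    unfold targetDensity; fun_prop
  calc ∫⁻ x in S, kernel V h x Sᶜ ∂target V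
      ≤ ∫⁻ x in S, ∫⁻ y, ENNReal.ofReal (proposalDensity V h x y * acceptProb V h x y)
          ∂volume ∂target V := by
        -- For `x` in `S` the rejection atom gives no mass to the complement; only accepted moves
        -- count.
        refine setLIntegral_mono' hS fun x hx => ?_
        unfold kernel
        rw [Measure.add_apply, Measure.smul_apply, Measure.dirac_apply' _ hS.compl,
          Set.indicator_of_notMem (by simpa using hx), smul_zero, zero_add,
          withDensity_apply _ hS.compl]
        exact setLIntegral_le_lintegral _ _
    _ ≤ ∫⁻ x, ∫⁻ y, ENNReal.ofReal (proposalDensity V h x y * acceptProb V h x y)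
          ∂volume ∂target V := setLIntegral_le_lintegral _ _
    _ ≤ ∫⁻ x, ENNReal.ofReal (targetDensity V x) *
          ∫⁻ y, ENNReal.ofReal (proposalDensity V h x y * acceptProb V h x y) :=
        lintegral_withDensity_le_lintegral_mul _ hπm _
    _ ≤ ∫⁻ x, ∫⁻ y, ENNReal.ofReal (√(flow V h x y) * √(flow V h y x)) := by
        refine lintegral_mono fun x => ?_
        rw [← lintegral_const_mul' _ _ ENNReal.ofReal_ne_top]
        refine lintegral_mono fun y => ?_
        rw [← ENNReal.ofReal_mul (hπ0 x), ← mul_assoc]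
        refine ENNReal.ofReal_le_ofReal ?_
        have ha := hpos x y
        have hb := hpos y x
        -- Multiplying by `p x y` turns the acceptance probability into `min (p x y) (p y x)`, which
        -- is at most the geometric mean.
        change flow V h x y * min 1 (flow V h y x / flow V h x y) ≤ _
        rw [mul_min_of_nonneg _ _ ha.le, mul_one, mul_div_cancel₀ _ ha.ne',
          ← Real.sqrt_mul ha.le]
        refine Real.le_sqrt_of_sq_le ?_
        rw [sq]
        exact mul_le_mul (min_le_left _ _) (min_le_right _ _) (le_min ha.le hb.le) ha.le

/-- A half-space through the origin has mass one half under an even target. -/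
theorem target_halfspace {V : EuclideanSpace ℝ (Fin d) → ℝ}
    (heven : ∀ x, V (-x) = V x) (hone : target V Set.univ = 1) (i : Fin d) :
    target V {x | x i < 0} = 1 / 2 := by
  have hm1 : MeasurableSet {x : EuclideanSpace ℝ (Fin d) | x i < 0} :=
    measurableSet_lt (by fun_prop) measurable_const
  have hm2 : MeasurableSet {x : EuclideanSpace ℝ (Fin d) | 0 < x i} :=
    measurableSet_lt measurable_const (by fun_prop)
  have hsymm : target V {x | 0 < x i} = target V {x | x i < 0} := by
    unfold target
    rw [withDensity_apply _ hm1, withDensity_apply _ hm2, ← lintegral_indicator hm1,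
      ← lintegral_indicator hm2, ← lintegral_neg_eq_self]
    refine lintegral_congr fun x => ?_
    simp [Set.indicator_apply, targetDensity, heven]
  have hnull : target V {x | x i = 0} = 0 := by
    refine withDensity_absolutelyContinuous _ _ ?_
    have h1 := Measure.addHaar_submodule (volume : Measure (EuclideanSpace ℝ (Fin d)))
      (EuclideanSpace.proj i : EuclideanSpace ℝ (Fin d) →L[ℝ] ℝ).ker (by
        intro htop
        have h2 : EuclideanSpace.single i (1 : ℝ) ∈
          (EuclideanSpace.proj i : EuclideanSpace ℝ (Fin d) →L[ℝ] ℝ).ker := by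
            rw [htop]; trivial
        simp at h2)
    refine (congrArg _ ?_).trans h1
    ext x; simp
  have hlower : 1 ≤ target V {x | x i < 0} * 2 := by
    calc (1 : ℝ≥0∞) = target V ({x | x i < 0} ∪ ({x | x i = 0} ∪ {x | 0 < x i})) := by
          rw [← hone]; congr 1; ext x; simpa using (lt_trichotomy (x i) 0)
      _ ≤ target V {x | x i < 0} + (target V {x | x i = 0} + target V {x | 0 < x i}) :=
          (measure_union_le _ _).trans (by gcongr; exact measure_union_le _ _)
      _ = target V {x | x i < 0} * 2 := by rw [hnull, hsymm, zero_add, mul_two]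
  have hupper : target V {x | x i < 0} * 2 ≤ 1 := by
    calc target V {x | x i < 0} * 2 = target V ({x | x i < 0} ∪ {x | 0 < x i}) := by
          have hdisj : Disjoint {x : EuclideanSpace ℝ (Fin d) | x i < 0} {x | 0 < x i} :=
            Set.disjoint_left.2 fun x hx hx' => lt_asymm (Set.mem_ofPred.1 hx) (Set.mem_ofPred.1 hx')
          rw [measure_union hdisj hm2, hsymm, mul_two]
      _ ≤ target V Set.univ := measure_mono (Set.subset_univ _)
      _ = 1 := hone
  exact (ENNReal.eq_div_iff (by norm_num) (by norm_num)).2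
    ((mul_comm _ _).trans (le_antisymm hupper hlower))

theorem target_sum_coordPotential_univ {L : ℝ} (hL : 1 ≤ L) :
    target (fun x : EuclideanSpace ℝ (Fin d) => ∑ i, coordPotential L (x i)) Set.univ = 1 := by
  have h0 := coordNormalizer_pos hL
  rw [target, withDensity_apply _ MeasurableSet.univ, setLIntegral_univ]
  simp_rw [targetDensity_sum_coordPotential, ENNReal.ofReal_prod_of_nonneg
    fun (i : Fin d) _ => (div_pos (Real.exp_pos _) h0).le]
  rw [lintegral_euclidean_prod d (fun _ t => ENNReal.ofReal
    (Real.exp (-coordPotential L t) / coordNormalizer L)) fun _ => by fun_prop]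
  simp [lintegral_exp_neg_coordPotential hL]

theorem conductance_le_of_measure_eq_half {E : Type*} [MeasurableSpace E] (T : E → Measure E)
    (π : Measure E) {S : Set E} (hS : MeasurableSet S) (hπ : π S = 1 / 2) :
    conductance T π ≤ 2 * ∫⁻ x in S, T x Sᶜ ∂π := by
  refine (iInf₂_le_of_le S hS (iInf₂_le_of_le (by simp [hπ]) hπ.le le_rfl)).trans ?_
  rw [hπ, ENNReal.div_eq_inv_mul]
  simp

/-- The conductance for the product target is controlled by the one-dimensional affinity. -/
theorem conductance_adversarialPotential_le {η h : ℝ} (hd : 1 ≤ d) (hη : 0 ≤ η) (hh : 0 < h) :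
    conductance (kernel (adversarialPotential d η) h) (target (adversarialPotential d η)) ≤
      2 * coordAffinity ((d : ℝ) ^ η) h ^ d := by
  have hL : 1 ≤ (d : ℝ) ^ η := Real.one_le_rpow (by exact_mod_cast hd) hη
  have hV : adversarialPotential d η =
      fun x : EuclideanSpace ℝ (Fin d) => ∑ i, coordPotential ((d : ℝ) ^ η) (x i) :=
    funext (adversarialPotential_eq_sum d η)
  rw [hV, ← lintegral_sqrt_flow_mul hL hh]
  have hm : Measurable fun x : EuclideanSpace ℝ (Fin d) =>
      ∑ i, coordPotential ((d : ℝ) ^ η) (x i) := by fun_prop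
  have hi : 0 < d := hd
  have hS : MeasurableSet {x : EuclideanSpace ℝ (Fin d) | x ⟨0, hi⟩ < 0} :=
    measurableSet_lt (by fun_prop) measurable_const
  refine (conductance_le_of_measure_eq_half _ _ hS
    (target_halfspace (fun x => by simp [coordPotential])
      (target_sum_coordPotential_univ hL) _)).trans ?_
  refine mul_le_mul' le_rfl (lintegral_kernel_compl_le hm (fun x y => ?_) hS)
  rw [flow_sum_coordPotential (by positivity) hh]
  exact Finset.prod_pos fun i _ => coordFlow_pos hL hh _ _

/-! ### The step-size window and the conclusion -/

/-- In the step-size window of the theorem and for large `d`, the frequency `L = d ^ (1/4 - δ)` and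
the step size `h` satisfy `1 ≪ L √h` and `h L ≪ 1`. -/
theorem exists_forall_window {δ : ℝ} (hδ : δ ∈ Set.Ioo (0 : ℝ) (1 / 18)) :
    ∃ N : ℕ, ∀ d : ℕ, N ≤ d → 1 ≤ d →
      ∀ h ∈ Set.Icc ((d : ℝ) ^ (-(1 / 2 : ℝ) + 3 * δ)) ((d : ℝ) ^ (-(1 / 3 : ℝ))),
        2 ≤ (d : ℝ) ^ (1 / 4 - δ) ∧ 32 ≤ (d : ℝ) ^ (1 / 4 - δ) * √h ∧
          h * (d : ℝ) ^ (1 / 4 - δ) ≤ 1 / 128 := by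
  obtain ⟨h0, h1⟩ := hδ
  have ht : ∀ e : ℝ, 0 < e → ∀ M : ℝ, ∀ᶠ d : ℕ in Filter.atTop, M ≤ (d : ℝ) ^ e := fun e he M =>
    ((tendsto_rpow_atTop he).comp tendsto_natCast_atTop_atTop).eventually_ge_atTop M
  -- The exponents come from `(1/4 - δ) + (-1/2 + 3δ) / 2 = δ / 2` for `L √h`, and `-1/3 + 1/4 - δ ≤
  -- -1/12` for `h L`.
  obtain ⟨N, hN⟩ := Filter.eventually_atTop.1 ((ht (1 / 4 - δ) (by linarith) 2).and
    ((ht (δ / 2) (by linarith) 32).and (ht (1 / 12) (by norm_num) 128)))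
  refine ⟨N, fun d hd hd1 h hh => ?_⟩
  obtain ⟨hA, hB, hC⟩ := hN d hd
  have hdR : (1 : ℝ) ≤ d := by exact_mod_cast hd1
  have hd0 : (0 : ℝ) < d := by linarith
  refine ⟨hA, ?_, ?_⟩
  · calc (32 : ℝ) ≤ (d : ℝ) ^ (δ / 2) := hB
      _ = (d : ℝ) ^ (1 / 4 - δ) * √((d : ℝ) ^ (-(1 / 2 : ℝ) + 3 * δ)) := by
        rw [Real.sqrt_eq_rpow, ← Real.rpow_mul hd0.le, ← Real.rpow_add hd0]
        congr 1; ring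
      _ ≤ _ := by gcongr; exact hh.1
  · calc h * (d : ℝ) ^ (1 / 4 - δ) ≤ (d : ℝ) ^ (-(1 / 3 : ℝ)) * (d : ℝ) ^ (1 / 4 - δ) := by
          gcongr; exact hh.2
      _ = (d : ℝ) ^ (-(1 / 3 : ℝ) + (1 / 4 - δ)) := (Real.rpow_add hd0 _ _).symm
      _ ≤ (d : ℝ) ^ (-(1 / 12 : ℝ)) := Real.rpow_le_rpow_of_exponent_le hdR (by linarith)
      _ = 1 / (d : ℝ) ^ (1 / 12 : ℝ) := (Real.rpow_neg hd0.le _).trans (one_div _).symm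
      _ ≤ 1 / 128 := by gcongr

end MALA

theorem theorem3 (δ : ℝ) (hδ : δ ∈ Set.Ioo (0 : ℝ) (1 / 18)) :
    ∃ C : ℝ, 0 < C ∧ ∃ c : ℝ, 0 < c ∧
      ∀ d : ℕ, 1 ≤ d →
      ∀ h ∈ Set.Icc ((d : ℝ) ^ (-(1 / 2 : ℝ) + 3 * δ)) ((d : ℝ) ^ (-(1 / 3 : ℝ))),
        MALA.conductance
            (MALA.kernel (MALA.adversarialPotential d (1 / 4 - δ)) h)
            (MALA.target (MALA.adversarialPotential d (1 / 4 - δ)))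
          ≤ ENNReal.ofReal (C * Real.exp (-(c * (d : ℝ) ^ (4 * δ)))) := by
  obtain ⟨N, hN⟩ := MALA.exists_forall_window hδ
  have hK := MALA.flowConstant_pos
  obtain ⟨h0, h1⟩ := hδ
  set c : ℝ := MALA.flowConstant / 8192 with hc
  have hc0 : 0 < c := by positivity
  -- The factor `exp (c N)` makes the bound trivial for `d < N`, where `d ^ (4δ) ≤ d ≤ N` and the
  -- affinity is at most 1.
  refine ⟨2 * Real.exp (c * N), by positivity, c, hc0, fun d hd h hh => ?_⟩
  have hdR : (1 : ℝ) ≤ d := by exact_mod_cast hd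
  have hd0 : (0 : ℝ) < d := by linarith
  have hh0 : 0 < h := (Real.rpow_pos_of_pos hd0 _).trans_le hh.1
  have hL1 : 1 ≤ (d : ℝ) ^ (1 / 4 - δ) := Real.one_le_rpow hdR (by linarith)
  refine (MALA.conductance_adversarialPotential_le hd (by linarith) hh0).trans ?_
  rw [mul_assoc, ENNReal.ofReal_mul (by norm_num), ENNReal.ofReal_ofNat, ← Real.exp_add]
  gcongr
  rcases le_or_gt N d with hNd | hNd
  · obtain ⟨hA, hB, hC⟩ := hN d hNd hd h hh
    have h2 := MALA.coordAffinity_le hA (Real.sqrt_pos.2 hh0) hB (by rwa [Real.sq_sqrt hh0.le])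
    rw [Real.sq_sqrt hh0.le, ← hc] at h2
    have h3 : (d : ℝ) ^ (4 * δ) ≤ d * (h / ((d : ℝ) ^ (1 / 4 - δ)) ^ 2) := by
      calc (d : ℝ) ^ (4 * δ) ≤ (d : ℝ) ^ (5 * δ) :=
            Real.rpow_le_rpow_of_exponent_le hdR (by linarith)
        -- Exponent count: `1 + (-1/2 + 3δ) - 2 (1/4 - δ) = 5δ`.
        _ = d * ((d : ℝ) ^ (-(1 / 2 : ℝ) + 3 * δ) / ((d : ℝ) ^ (1 / 4 - δ)) ^ 2) := by
            rw [← Real.rpow_mul_natCast hd0.le, ← Real.rpow_sub hd0]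
            nth_rw 2 [← Real.rpow_one (d : ℝ)]
            rw [← Real.rpow_add hd0]
            congr 1; push_cast; ring
        _ ≤ _ := by gcongr; exact hh.1
    calc MALA.coordAffinity ((d : ℝ) ^ (1 / 4 - δ)) h ^ d
        ≤ ENNReal.ofReal (Real.exp (-(c * (h / ((d : ℝ) ^ (1 / 4 - δ)) ^ 2)))) ^ d := by gcongr
      _ = ENNReal.ofReal (Real.exp (d * -(c * (h / ((d : ℝ) ^ (1 / 4 - δ)) ^ 2)))) := by
          rw [← ENNReal.ofReal_pow (Real.exp_pos _).le, Real.exp_nat_mul]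
      _ ≤ _ := by
          refine ENNReal.ofReal_le_ofReal (Real.exp_le_exp.2 ?_)
          have h4 := mul_le_mul_of_nonneg_left h3 hc0.le
          have h5 : 0 ≤ c * N := by positivity
          linarith
  · have h2 : (d : ℝ) ^ (4 * δ) ≤ N :=
      calc (d : ℝ) ^ (4 * δ) ≤ (d : ℝ) ^ (1 : ℝ) :=
            Real.rpow_le_rpow_of_exponent_le hdR (by linarith)
        _ = d := Real.rpow_one _
        _ ≤ N := by exact_mod_cast hNd.le
    have h3 := mul_le_mul_of_nonneg_left h2 hc0.le
    refine (pow_le_one' (MALA.coordAffinity_le_one hL1 hh0) d).trans ?_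
    rw [← ENNReal.ofReal_one]
    exact ENNReal.ofReal_le_ofReal (Real.one_le_exp (by linarith))
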